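/- Let $d\ge 0$, let $D\in M_d(\mathbb R)$ be antisymmetric, and let $\mathcal A_D$ be the noncommutative torus, i.e. the universal $\mathrm C^*$-algebra generated by unitaries $U_1,\dots,U_d$ with $U_jU_k=e^{-2\pi i D_{jk}}U_kU_j$ for all $j,k$. For $x\in\mathbb Z^d$ put $U_x:=U_1^{x_1}U_2^{x_2}\cdots U_d^{x_d}$, and let $H:=\{x\in\mathbb Z^d : \langle x, Dy\rangle\in\mathbb Z \text{ for all } y\in\mathbb Z^d\}$. Let $\{p_1,\dots,p_d\}$ be a basis of $\mathbb Z^d$ and let $a_1,\dots,a_m$ be positive integers such that $\{a_1p_1,\dots,a_mp_m\}$ is a basis of $H$ (such a choice exists, and $m=\operatorname{rank}H$). Let $\gamma'$ be the action of $\mathbb T^d$ on $\mathcal A_D$ by automorphisms with $\gamma'_\lambda(U_{p_i})=\lambda_iU_{p_i}$ for $i=1,\dots,d$; let $\Lambda:=\{\lambda\in\mathbb T^d : \lambda_i^{a_i}=1 \text{ for } 1\le i\le m\}\cong \mathbb Z_{a_1}\times\cdots\times\mathbb Z_{a_m}\times\mathbb T^{d-m}$; and let $E^\Lambda(x):=\int_\Lambda\gamma'_\lambda(x)\,d\lambda$,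 the integral being with respect to normalised Haar measure. Then $E^\Lambda$ is a conditional expectation of $\mathcal A_D$ onto its centre $\mathrm Z(\mathcal A_D)$ (a contractive positive $\mathrm Z(\mathcal A_D)$-bimodule map onto $\mathrm Z(\mathcal A_D)$ which restricts to the identity there), and the map $\omega\mapsto\omega\circ E^\Lambda$ is an affine homeomorphism, for the weak* topologies, of the state space of $\mathrm Z(\mathcal A_D)$ onto the space of tracial states of $\mathcal A_D$. Moreover, every linear functional $\tau$ on $\mathcal A_D$ with $\tau(xy)=\tau(yx)$ for all $x,y$, in particular every tracial state, satisfies $\tau(U_b)=0$ for all $b\in\mathbb Z^d\setminus H$. -/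

import Mathlib

open scoped ComplexConjugate ComplexOrder

noncomputable section

namespace NCTorus

/-! ### The group `*`-algebra of the free group -/

/-- The free `*`-algebra on `d` unitaries: the complex group algebra of the free group on `d`
generators. Its involution (below) is conjugate linear and inverts group elements. -/
def FreeStarAlg (d : ℕ) : Type := MonoidAlgebra ℂ (FreeGroup (Fin d))

instance (d : ℕ) : Ring (FreeStarAlg d) := inferInstanceAs (Ring (MonoidAlgebra ℂ _))

instance (d : ℕ) : Algebra ℂ (FreeStarAlg d) := inferInstanceAs (Algebra ℂ (MonoidAlgebra ℂ _))

namespace FreeStarAlg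

variable {d : ℕ}

/-- The element `c • g` of the group algebra. -/
def mono (g : FreeGroup (Fin d)) (c : ℂ) : FreeStarAlg d := MonoidAlgebra.single g c

/-- The `j`-th generator. -/
def gen (j : Fin d) : FreeStarAlg d := mono (FreeGroup.of j) 1

theorem mono_mul (g h : FreeGroup (Fin d)) (a b : ℂ) :
    mono g a * mono h b = mono (g * h) (a * b) := MonoidAlgebra.single_mul_single ..

theorem mono_one : (mono 1 1 : FreeStarAlg d) = 1 := rfl

theorem mono_add (g : FreeGroup (Fin d)) (a b : ℂ) : mono g (a + b) = mono g a + mono g b :=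
  MonoidAlgebra.single_add ..

theorem mono_zero (g : FreeGroup (Fin d)) : (mono g 0 : FreeStarAlg d) = 0 :=
  MonoidAlgebra.single_zero g

theorem smul_mono (g : FreeGroup (Fin d)) (a b : ℂ) : a • mono g b = mono g (a * b) :=
  MonoidAlgebra.smul_single' ..

theorem induct {motive : FreeStarAlg d → Prop} (x : FreeStarAlg d)
    (mono : ∀ g c, motive (mono g c)) (add : ∀ x y, motive x → motive y → motive (x + y)) :
    motive x :=
  MonoidAlgebra.induction_linear (motive := motive) x
    (by simpa [FreeStarAlg.mono] using mono 1 0) (fun x y => add x y) (fun g c => mono g c)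

/-- The involution, as an additive map: `∑ c_g g ↦ ∑ conj(c_g) g⁻¹`. -/
def starMap : FreeStarAlg d →+ FreeStarAlg d where
  toFun x := x.coeff.sum fun g c => mono g⁻¹ (conj c)
  map_zero' := Finsupp.sum_zero_index
  map_add' x y := Finsupp.sum_add_index' (fun g => by simp only [map_zero, mono_zero])
    (fun g a b => by rw [map_add, mono_add])

instance : Star (FreeStarAlg d) := ⟨starMap⟩

theorem star_mono (g : FreeGroup (Fin d)) (c : ℂ) : star (mono g c) = mono g⁻¹ (conj c) := by
  change Finsupp.sum (Finsupp.single g c) (fun g c => (mono g⁻¹ (conj c) : FreeStarAlg d)) = _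
  exact Finsupp.sum_single_index (by simp only [map_zero, mono_zero])

theorem star_add' (x y : FreeStarAlg d) : star (x + y) = star x + star y := map_add starMap x y

instance : StarRing (FreeStarAlg d) where
  star_involutive x := by
    induction x using induct with
    | mono g c => simp [star_mono]
    | add x y hx hy => rw [star_add', star_add', hx, hy]
  star_mul x y := by
    induction x using induct with
    | mono g c =>
      induction y using induct with
      | mono h c' => simp [star_mono, mono_mul, mul_comm]
      | add x y hx hy => rw [mul_add, star_add', star_add', add_mul, hx, hy]
    | add x y hx hy => rw [add_mul, star_add', star_add', mul_add, hx, hy]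
  star_add := star_add'

instance : StarModule ℂ (FreeStarAlg d) where
  star_smul c x := by
    induction x using induct with
    | mono g c' => simp [star_mono, smul_mono]
    | add x y hx hy => rw [smul_add, star_add', star_add', smul_add, hx, hy]

theorem gen_mem_unitary (j : Fin d) : gen j ∈ unitary (FreeStarAlg d) := by
  rw [Unitary.mem_iff]
  simp [gen, star_mono, mono_mul, mono_one]

end FreeStarAlg

open FreeStarAlg

/-! ### The noncommutative torus -/

section Construction

variable {d : ℕ} (D : Matrix (Fin d) (Fin d) ℝ)

/-- The scalar `exp(-2πi D_{jk})`. -/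
def phase (j k : Fin d) : ℂ := Complex.exp (-2 * Real.pi * Complex.I * (D j k : ℂ))

/-- A `C^*`-seminorm on the free `*`-algebra on `d` unitaries which vanishes on the defining
relations `U_j U_k = exp(-2πi D_{jk}) U_k U_j`. -/
structure IsTorusSeminorm (p : RingSeminorm (FreeStarAlg d)) : Prop where
  smul : ∀ (c : ℂ) (x : FreeStarAlg d), p (c • x) = ‖c‖ * p x
  cstar : ∀ x : FreeStarAlg d, p (star x * x) = p x ^ 2
  rel : ∀ j k : Fin d, p (gen j * gen k - phase D j k • (gen k * gen j)) = 0

/-- The set of all `C^*`-seminorms compatible with the relations. -/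
abbrev TorusSeminorm : Type := {p : RingSeminorm (FreeStarAlg d) // IsTorusSeminorm D p}

instance : Nonempty (TorusSeminorm D) :=
  ⟨⟨0, ⟨fun c x => by change (0 : ℝ) = ‖c‖ * 0; simp, fun x => by change (0 : ℝ) = 0 ^ 2; simp,
    fun j k => rfl⟩⟩⟩

variable {D}

theorem TorusSeminorm.mono_le (p : TorusSeminorm D) (g : FreeGroup (Fin d)) (c : ℂ) :
    p.1 (mono g c) ≤ ‖c‖ := by
  have h1 : p.1 1 = p.1 1 ^ 2 := by simpa using p.2.cstar 1
  have h1' : p.1 1 ≤ 1 := by nlinarith [sq_nonneg (p.1 1 - 1)]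
  have h2 : p.1 (mono g 1) ^ 2 = p.1 1 := by
    rw [← p.2.cstar, star_mono, mono_mul, ← mono_one]; simp
  have h3 : p.1 (mono g 1) ≤ 1 := by
    nlinarith [apply_nonneg p.1 (mono g 1)]
  have h4 := p.2.smul c (mono g 1)
  rw [smul_mono, mul_one] at h4
  rw [h4]
  exact mul_le_of_le_one_right (norm_nonneg c) h3

theorem TorusSeminorm.bddAbove (x : FreeStarAlg d) :
    BddAbove (Set.range fun p : TorusSeminorm D => p.1 x) := by
  induction x using induct with
  | mono g c => exact ⟨‖c‖, by rintro _ ⟨p, rfl⟩; exact p.mono_le g c⟩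
  | add x y hx hy =>
    obtain ⟨a, ha⟩ := hx
    obtain ⟨b, hb⟩ := hy
    refine ⟨a + b, ?_⟩
    rintro _ ⟨p, rfl⟩
    exact (map_add_le_add p.1 x y).trans (add_le_add (ha ⟨p, rfl⟩) (hb ⟨p, rfl⟩))

theorem TorusSeminorm.le_iSup (p : TorusSeminorm D) (x : FreeStarAlg d) :
    p.1 x ≤ ⨆ q : TorusSeminorm D, q.1 x := le_ciSup (bddAbove x) p

variable (D)

/-- The universal `C^*`-seminorm: the supremum of all `C^*`-seminorms compatible with the
relations. -/
def univSeminorm : RingSeminorm (FreeStarAlg d) where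
  toFun x := ⨆ p : TorusSeminorm D, p.1 x
  map_zero' := by simp
  add_le' x y := ciSup_le fun p => (map_add_le_add p.1 x y).trans
    (add_le_add (p.le_iSup x) (p.le_iSup y))
  neg' x := by simp
  mul_le' x y := ciSup_le fun p => (map_mul_le_mul p.1 x y).trans
    (mul_le_mul (p.le_iSup x) (p.le_iSup y) (apply_nonneg _ _)
      ((apply_nonneg p.1 x).trans (p.le_iSup x)))

variable {D}

theorem TorusSeminorm.le_univ (p : TorusSeminorm D) (x : FreeStarAlg d) :
    p.1 x ≤ univSeminorm D x := p.le_iSup x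

theorem univSeminorm_le {x : FreeStarAlg d} {a : ℝ} (h : ∀ p : TorusSeminorm D, p.1 x ≤ a) :
    univSeminorm D x ≤ a := ciSup_le h

variable (D)

theorem univSeminorm_isTorusSeminorm : IsTorusSeminorm D (univSeminorm D) where
  smul c x := by
    change (⨆ p : TorusSeminorm D, p.1 (c • x)) = ‖c‖ * ⨆ p : TorusSeminorm D, p.1 x
    rw [Real.mul_iSup_of_nonneg (norm_nonneg c)]
    exact iSup_congr fun p => p.2.smul c x
  cstar x := by
    apply le_antisymm
    · refine univSeminorm_le fun p => ?_
      rw [p.2.cstar]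
      exact pow_le_pow_left₀ (apply_nonneg _ _) (p.le_univ x) 2
    · have h0 : 0 ≤ univSeminorm D (star x * x) := apply_nonneg _ _
      have : univSeminorm D x ≤ √(univSeminorm D (star x * x)) :=
        univSeminorm_le fun p => Real.le_sqrt_of_sq_le (by
          rw [← p.2.cstar]; exact p.le_univ _)
      calc univSeminorm D x ^ 2 ≤ √(univSeminorm D (star x * x)) ^ 2 :=
            pow_le_pow_left₀ (apply_nonneg _ _) this 2
        _ = _ := Real.sq_sqrt h0
  rel j k := le_antisymm (univSeminorm_le fun p => (p.2.rel j k).le) (apply_nonneg _ _)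

/-- The free `*`-algebra on `d` unitaries, with the topology of the universal `C^*`-seminorm. -/
def Pre (_D : Matrix (Fin d) (Fin d) ℝ) : Type := FreeStarAlg d

instance : SeminormedRing (Pre D) := (univSeminorm D).toSeminormedRing

instance : NormedAlgebra ℂ (Pre D) where
  __ := (inferInstanceAs (Algebra ℂ (FreeStarAlg d)) : Algebra ℂ (FreeStarAlg d))
  norm_smul_le c x := ((univSeminorm_isTorusSeminorm D).smul c x).le

instance : StarRing (Pre D) := inferInstanceAs (StarRing (FreeStarAlg d))

instance : StarModule ℂ (Pre D) := inferInstanceAs (StarModule ℂ (FreeStarAlg d))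

theorem Pre.norm_star_mul_self (x : Pre D) : ‖star x * x‖ = ‖x‖ ^ 2 :=
  (univSeminorm_isTorusSeminorm D).cstar x

theorem Pre.norm_star_le (x : Pre D) : ‖x‖ ≤ ‖star x‖ := by
  by_cases h : ‖x‖ = 0
  · rw [h]; exact norm_nonneg _
  · have h1 := norm_mul_le (star x) x
    rw [Pre.norm_star_mul_self, sq] at h1
    exact le_of_mul_le_mul_right h1 (lt_of_le_of_ne (norm_nonneg x) (Ne.symm h))

instance : NormedStarGroup (Pre D) where
  norm_star_le x := by simpa using Pre.norm_star_le D (star x)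

end Construction

/-- The noncommutative torus `𝒜_D`: the universal `C^*`-algebra generated by unitaries
`U_1, …, U_d` with `U_j U_k = exp(-2πi D_{jk}) U_k U_j`, constructed as the Hausdorff completion
of the free `*`-algebra on `d` unitaries in the universal `C^*`-seminorm. -/
def Torus {d : ℕ} (D : Matrix (Fin d) (Fin d) ℝ) : Type := UniformSpace.Completion (Pre D)

namespace Torus

open UniformSpace

variable {d : ℕ} (D : Matrix (Fin d) (Fin d) ℝ)

instance : NormedRing (Torus D) := inferInstanceAs (NormedRing (Completion (Pre D)))

instance : CompleteSpace (Torus D) := inferInstanceAs (CompleteSpace (Completion (Pre D)))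

/-- The canonical map from the free `*`-algebra on `d` unitaries. -/
def of : FreeStarAlg d →+* Torus D := (Completion.coeRingHom : Pre D →+* Completion (Pre D))

instance : Algebra ℂ (Torus D) := inferInstanceAs (Algebra ℂ (Completion (Pre D)))

instance : NormedAlgebra ℂ (Torus D) where
  norm_smul_le c x := norm_smul_le c (show Completion (Pre D) from x)

instance : Star (Torus D) := ⟨Completion.map (star : Pre D → Pre D)⟩

variable {D}

theorem norm_of (x : FreeStarAlg d) : ‖of D x‖ = univSeminorm D x :=
  Completion.norm_coe (E := Pre D) x

theorem denseRange_of : DenseRange (of D) := Completion.denseRange_coe (α := Pre D)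

theorem of_smul (c : ℂ) (x : FreeStarAlg d) : of D (c • x) = c • of D x :=
  Completion.coe_smul (X := Pre D) c x

theorem of_algebraMap (c : ℂ) : of D (algebraMap ℂ _ c) = algebraMap ℂ _ c := rfl

theorem star_of (x : FreeStarAlg d) : star (of D x) = of D (star x) :=
  Completion.map_coe (star_isometry (E := Pre D)).uniformContinuous x

@[fun_prop]
theorem continuous_star' : Continuous (star : Torus D → Torus D) := Completion.continuous_map

theorem induct {motive : Torus D → Prop} (x : Torus D) (hc : IsClosed {x | motive x})
    (h : ∀ x, motive (of D x)) : motive x := Completion.induction_on (α := Pre D) x hc h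

theorem star_mul' (x y : Torus D) : star (x * y) = star y * star x := by
  induction x using induct with
  | hc => exact isClosed_eq (by fun_prop) (by fun_prop)
  | h x =>
    induction y using induct with
    | hc => exact isClosed_eq (by fun_prop) (by fun_prop)
    | h y =>
      rw [← map_mul, star_of, star_of, star_of, star_mul, map_mul]

theorem star_add' (x y : Torus D) : star (x + y) = star x + star y := by
  induction x using induct with
  | hc => exact isClosed_eq (by fun_prop) (by fun_prop)
  | h x =>
    induction y using induct with
    | hc => exact isClosed_eq (by fun_prop) (by fun_prop)
    | h y =>
      rw [← map_add, star_of, star_of, star_of, star_add, map_add]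

instance : StarRing (Torus D) where
  star_involutive x := by
    induction x using induct with
    | hc => exact isClosed_eq (by fun_prop) (by fun_prop)
    | h x =>
      rw [star_of, star_of, star_star]
  star_mul := star_mul'
  star_add := star_add'

theorem star_smul' (c : ℂ) (x : Torus D) : star (c • x) = conj c • star x := by
  have h1 : Continuous fun x : Torus D => star (c • x) :=
    continuous_star'.comp (continuous_const_smul c)
  have h2 : Continuous fun x : Torus D => conj c • star x :=
    (continuous_const_smul (conj c)).comp continuous_star'
  induction x using induct with
  | hc => exact isClosed_eq h1 h2
  | h x => rw [← of_smul, star_of, star_of, star_smul, of_smul]; rfl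

instance : StarModule ℂ (Torus D) := ⟨star_smul'⟩

instance : CStarRing (Torus D) where
  norm_mul_self_le x := by
    refine le_of_eq ?_
    induction x using induct with
    | hc => exact isClosed_eq (by fun_prop) (by fun_prop)
    | h x =>
      rw [star_of, ← map_mul, norm_of, norm_of, (univSeminorm_isTorusSeminorm D).cstar, sq]

instance : CStarAlgebra (Torus D) where

variable (D)

/-- The canonical unitary generators `U_1, …, U_d` of the noncommutative torus. -/
def U (j : Fin d) : unitary (Torus D) :=
  ⟨of D (gen j), by
    have h := Unitary.mem_iff.1 (gen_mem_unitary j)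
    rw [Unitary.mem_iff, star_of, ← map_mul, ← map_mul, h.1, h.2, map_one]
    exact ⟨rfl, rfl⟩⟩

theorem coe_U (j : Fin d) : (U D j : Torus D) = of D (gen j) := rfl

/-- The defining relations. -/
theorem U_mul_U (j k : Fin d) :
    (U D j : Torus D) * U D k = phase D j k • ((U D k : Torus D) * U D j) := by
  rw [← sub_eq_zero, ← norm_eq_zero, coe_U, coe_U, ← map_mul, ← map_mul, ← of_smul, ← map_sub,
    norm_of]
  exact (univSeminorm_isTorusSeminorm D).rel j k

variable {D}

/-! ### The universal property -/

section Lift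

variable {B : Type*} [CStarAlgebra B] (V : Fin d → unitary B)

/-- The unital homomorphism of `ℂ[F_d]` determined by `d` unitaries. -/
def preLift : FreeStarAlg d →ₐ[ℂ] B :=
  MonoidAlgebra.lift ℂ B (FreeGroup (Fin d))
    ((unitary B).subtype.comp (FreeGroup.lift V))

theorem preLift_mono (g : FreeGroup (Fin d)) (c : ℂ) :
    preLift V (mono g c) = c • (FreeGroup.lift V g : B) := MonoidAlgebra.lift_single ..

theorem preLift_gen (j : Fin d) : preLift V (gen j) = V j := by
  simp [gen, preLift_mono]

theorem preLift_star (x : FreeStarAlg d) : preLift V (star x) = star (preLift V x) := by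
  induction x using FreeStarAlg.induct with
  | mono g c => rw [star_mono, preLift_mono, preLift_mono, star_smul, map_inv]; rfl
  | add x y hx hy => rw [star_add, map_add, map_add, star_add, hx, hy]

variable {V}

theorem norm_preLift_le
    (hV : ∀ j k, (V j : B) * V k = phase D j k • ((V k : B) * V j)) (x : FreeStarAlg d) :
    ‖preLift V x‖ ≤ univSeminorm D x := by
  let p : RingSeminorm (FreeStarAlg d) :=
    { toFun := fun x => ‖preLift V x‖
      map_zero' := by simp
      add_le' := fun x y => by rw [map_add]; exact norm_add_le _ _
      neg' := fun x => by rw [map_neg, norm_neg]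
      mul_le' := fun x y => by rw [map_mul]; exact norm_mul_le _ _ }
  have hp : IsTorusSeminorm D p :=
    { smul := fun c x => by
        change ‖preLift V (c • x)‖ = ‖c‖ * ‖preLift V x‖
        rw [map_smul, norm_smul]
      cstar := fun x => by
        change ‖preLift V (star x * x)‖ = ‖preLift V x‖ ^ 2
        rw [map_mul, preLift_star, CStarRing.norm_star_mul_self, sq]
      rel := fun j k => by
        change ‖preLift V _‖ = 0
        rw [map_sub, map_smul, map_mul, map_mul, preLift_gen, preLift_gen, hV, sub_self,
          norm_zero] }
  exact TorusSeminorm.le_univ ⟨p, hp⟩ x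

/-- The extension of `preLift` to the completion. -/
def liftRingHom (hV : ∀ j k, (V j : B) * V k = phase D j k • ((V k : B) * V j)) :
    Torus D →+* B :=
  Completion.extensionHom (α := Pre D) (preLift V : FreeStarAlg d →+* B)
    (AddMonoidHomClass.lipschitz_of_bound (E := Pre D) (preLift V : FreeStarAlg d →+* B) 1
      fun x => (norm_preLift_le hV x).trans_eq (one_mul _).symm).continuous

theorem continuous_liftRingHom
    (hV : ∀ j k, (V j : B) * V k = phase D j k • ((V k : B) * V j)) :
    Continuous (liftRingHom hV) := Completion.continuous_extension

theorem liftRingHom_of (hV : ∀ j k, (V j : B) * V k = phase D j k • ((V k : B) * V j))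
    (x : FreeStarAlg d) : liftRingHom hV (of D x) = preLift V x :=
  Completion.extensionHom_coe (α := Pre D) _ _ x

/-- The universal property: unitaries `V_1, …, V_d` of a `C^*`-algebra `B` satisfying the
defining relations induce a unital `*`-homomorphism `𝒜_D → B` with `U_j ↦ V_j`. -/
def lift (V : Fin d → unitary B)
    (hV : ∀ j k, (V j : B) * V k = phase D j k • ((V k : B) * V j)) : Torus D →⋆ₐ[ℂ] B where
  __ := liftRingHom hV
  commutes' c := by
    change liftRingHom hV (algebraMap ℂ _ c) = _
    rw [← of_algebraMap, liftRingHom_of, AlgHom.commutes]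
  map_star' x := by
    change liftRingHom hV (star x) = star (liftRingHom hV x)
    have hc := continuous_liftRingHom hV
    induction x using induct with
    | hc => exact isClosed_eq (by fun_prop) (by fun_prop)
    | h x =>
      rw [star_of, liftRingHom_of, liftRingHom_of, preLift_star]

theorem lift_U (hV : ∀ j k, (V j : B) * V k = phase D j k • ((V k : B) * V j)) (j : Fin d) :
    lift V hV (U D j) = V j := (liftRingHom_of hV _).trans (preLift_gen V j)

end Lift

/-- The generators generate: two continuous unital `*`-homomorphisms which agree on the `U_j` are
equal, so the homomorphism in the universal property is unique. -/
theorem hom_ext {B : Type*} [CStarAlgebra B] {f g : Torus D →⋆ₐ[ℂ] B}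
    (h : ∀ j, f (U D j) = g (U D j)) : f = g := by
  have hf : Continuous f := (AddMonoidHomClass.lipschitz_of_bound f 1 fun x =>
    (NonUnitalStarAlgHom.norm_apply_le f x).trans_eq (one_mul _).symm).continuous
  have hg : Continuous g := (AddMonoidHomClass.lipschitz_of_bound g 1 fun x =>
    (NonUnitalStarAlgHom.norm_apply_le g x).trans_eq (one_mul _).symm).continuous
  have key : ∀ w : FreeGroup (Fin d), f (of D (mono w 1)) = g (of D (mono w 1)) := by
    intro w
    induction w using FreeGroup.induction_on with
    | C1 => rw [mono_one, map_one, map_one, map_one]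
    | of j => exact h j
    | inv_of j _ =>
      have : (mono (FreeGroup.of j)⁻¹ 1 : FreeStarAlg d) = star (gen j) := by
        rw [gen, star_mono, map_one]
      change f (of D (mono (FreeGroup.of j)⁻¹ 1)) = g (of D (mono (FreeGroup.of j)⁻¹ 1))
      rw [this, ← star_of, map_star, map_star]
      exact congrArg star (h j)
    | mul v w hv hw =>
      have : (mono (v * w) 1 : FreeStarAlg d) = mono v 1 * mono w 1 := by rw [mono_mul, one_mul]
      rw [this, map_mul, map_mul, map_mul, hv, hw]
  ext x
  induction x using induct with
  | hc => exact isClosed_eq hf hg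
  | h x =>
    induction x using FreeStarAlg.induct with
    | mono w c =>
      have : (mono w c : FreeStarAlg d) = c • mono w 1 := by rw [smul_mono, mul_one]
      rw [this, of_smul, map_smul, map_smul, key]
    | add x y hx hy => rw [map_add, map_add, map_add, hx, hy]

/-- For `x ∈ ℤ^d`, the ordered product `U_x = U_1^{x_1} U_2^{x_2} ⋯ U_d^{x_d}`. -/
def Ux (D : Matrix (Fin d) (Fin d) ℝ) (x : Fin d → ℤ) : unitary (Torus D) :=
  (List.ofFn fun j => U D j ^ x j).prod

variable (D)

/-- The scalar unitaries of `𝒜_D`. -/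
def scalar : Circle →* unitary (Torus D) where
  toFun z := ⟨algebraMap ℂ (Torus D) z, by
    rw [Unitary.mem_iff, ← algebraMap_star_comm, ← map_mul, ← map_mul]
    simp [← Complex.normSq_eq_conj_mul_self, Complex.mul_conj]⟩
  map_one' := Subtype.ext (by simp)
  map_mul' z w := Subtype.ext (by simp)

variable {D}

theorem coe_scalar (z : Circle) : (scalar D z : Torus D) = algebraMap ℂ (Torus D) z := rfl

theorem scalar_commute (z : Circle) (u : unitary (Torus D)) : Commute (scalar D z) u :=
  Subtype.ext (Algebra.commutes (z : ℂ) (u : Torus D))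

end Torus

open Torus

/-! ### The degeneracy subgroup, the group `Λ` and the action -/

variable {d : ℕ}

/-- The subgroup `H = {x ∈ ℤ^d | ⟨x, D y⟩ ∈ ℤ for all y ∈ ℤ^d}` of `ℤ^d`. -/
def H (D : Matrix (Fin d) (Fin d) ℝ) : Submodule ℤ (Fin d → ℤ) where
  carrier := {x | ∀ y : Fin d → ℤ, ∃ n : ℤ,
    (fun i => (x i : ℝ)) ⬝ᵥ D.mulVec (fun i => (y i : ℝ)) = n}
  zero_mem' y := ⟨0, by simp [dotProduct]⟩
  add_mem' {x x'} hx hx' y := by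
    obtain ⟨n, hn⟩ := hx y
    obtain ⟨n', hn'⟩ := hx' y
    refine ⟨n + n', ?_⟩
    rw [Int.cast_add, ← hn, ← hn', ← add_dotProduct]
    congr 1
    ext i
    simp
  smul_mem' c x hx y := by
    obtain ⟨n, hn⟩ := hx y
    refine ⟨c * n, ?_⟩
    rw [Int.cast_mul, ← hn, ← smul_eq_mul, ← smul_dotProduct]
    congr 1
    ext i
    simp

/-- A basis `p_1, …, p_d` of `ℤ^d` together with positive integers `a_1, …, a_m` such that
`a_1 p_1, …, a_m p_m` is a basis of `H` (these vectors are automatically linearly independent,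
so this says that they span `H`; in particular `m` is the rank of `H`). -/
structure AdaptedBasis (D : Matrix (Fin d) (Fin d) ℝ) where
  /-- the degeneracy index -/
  m : ℕ
  m_le : m ≤ d
  /-- the basis of `ℤ^d` -/
  p : Module.Basis (Fin d) ℤ (Fin d → ℤ)
  /-- the multipliers -/
  a : Fin m → ℕ
  a_pos : ∀ i, 0 < a i
  span_eq : Submodule.span ℤ (Set.range fun i : Fin m => (a i : ℤ) • p (Fin.castLE m_le i)) = H D

namespace AdaptedBasis

/-- Adapted bases exist. -/
theorem nonempty (D : Matrix (Fin d) (Fin d) ℝ) : Nonempty (AdaptedBasis D) := by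
  obtain ⟨n, bM, bN, f, a, snf⟩ := Submodule.smithNormalForm (Pi.basisFun ℤ (Fin d)) (H D)
  have hn : n ≤ d := by simpa using Fintype.card_le_of_embedding f
  obtain ⟨e, he⟩ : ∃ e : Equiv.Perm (Fin d), ∀ i : Fin n, e (Fin.castLE hn i) = f i := by
    obtain ⟨e, he⟩ := Equiv.Perm.exists_extending_pair (Fin.castLE hn) f
      (Fin.castLE_injective hn) f.injective
    exact ⟨e, he⟩
  have ha : ∀ i, a i ≠ 0 := fun i h => bN.ne_zero i (Subtype.ext (by rw [snf i, h, zero_smul]; rfl))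
  refine ⟨⟨n, hn, bM.reindex e.symm, fun i => (a i).natAbs, fun i => Int.natAbs_pos.2 (ha i), ?_⟩⟩
  have hp : ∀ i : Fin n, (bM.reindex e.symm) (Fin.castLE hn i) = bM (f i) := fun i => by simp [he]
  have hspan : Submodule.span ℤ (Set.range fun i => (bN i : Fin d → ℤ)) = H D := by
    have := congrArg (Submodule.map (H D).subtype) bN.span_eq
    rw [Submodule.map_span, ← Set.range_comp, Submodule.map_subtype_top] at this
    exact this
  rw [← hspan]
  apply le_antisymm <;> rw [Submodule.span_le] <;> rintro _ ⟨i, rfl⟩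
  · have hi := Submodule.subset_span (R := ℤ) (Set.mem_range_self (f := fun i => (bN i : Fin d → ℤ)) i)
    simp only [hp, SetLike.mem_coe]
    rcases Int.natAbs_eq (a i) with h | h
    · rw [← h, ← snf]; exact hi
    · rw [show (((a i).natAbs : ℤ)) = -a i by omega, neg_smul, ← snf]; exact neg_mem hi
  · have hi := Submodule.subset_span (R := ℤ) (Set.mem_range_self
      (f := fun i : Fin n => ((a i).natAbs : ℤ) • (bM.reindex e.symm) (Fin.castLE hn i)) i)
    simp only [SetLike.mem_coe]
    rw [snf, ← hp]
    rcases Int.natAbs_eq (a i) with h | h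
    · rw [h]; exact hi
    · rw [h, neg_smul]; exact neg_mem hi

variable {D : Matrix (Fin d) (Fin d) ℝ} (P : AdaptedBasis D)

/-- The compact group `Λ = ℤ_{a_1} × ⋯ × ℤ_{a_m} × 𝕋^{d-m} ⊆ 𝕋^d`. -/
def Lam : Subgroup (Fin d → Circle) where
  carrier := {z | ∀ i : Fin P.m, z (Fin.castLE P.m_le i) ^ P.a i = 1}
  one_mem' i := one_pow _
  mul_mem' {z w} hz hw i := by rw [Pi.mul_apply, mul_pow, hz i, hw i, one_mul]
  inv_mem' {z} hz i := by rw [Pi.inv_apply, inv_pow, hz i, inv_one]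

theorem isClosed_Lam : IsClosed (P.Lam : Set (Fin d → Circle)) := by
  have : (P.Lam : Set (Fin d → Circle)) =
      ⋂ i : Fin P.m, {z | z (Fin.castLE P.m_le i) ^ P.a i = 1} := by
    ext z
    simp [Lam]
  rw [this]
  exact isClosed_iInter fun i => isClosed_eq (by fun_prop) continuous_const

instance : CompactSpace P.Lam := isCompact_iff_compactSpace.1 P.isClosed_Lam.isCompact

instance : MeasurableSpace P.Lam := borel P.Lam

instance : BorelSpace P.Lam := ⟨rfl⟩

/-- The normalised Haar measure of `Λ`. -/
def haarLam : MeasureTheory.Measure P.Lam := MeasureTheory.Measure.haarMeasure ⊤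

/-- The character of `ℤ^d` with value `z_i` at `p_i`. -/
def char (z : Fin d → Circle) (x : Fin d → ℤ) : Circle := ∏ i, z i ^ P.p.repr x i

/-- The action `γ'` of `𝕋^d` on `𝒜_D` with `γ'_z(U_{p_i}) = z_i U_{p_i}`: it multiplies each
generator `U_j` by the value at `e_j` of the character of `ℤ^d` which maps `p_i` to `z_i`. -/
def gamma (z : Fin d → Circle) : Torus D →⋆ₐ[ℂ] Torus D :=
  lift (fun j => scalar D (P.char z (Pi.single j 1)) * U D j) fun j k => by
    simp only [Submonoid.coe_mul, coe_scalar, ← Algebra.smul_def, smul_mul_smul_comm]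
    rw [U_mul_U, smul_comm, mul_comm]

theorem gamma_U (z : Fin d → Circle) (j : Fin d) :
    P.gamma z (U D j) = P.char z (Pi.single j 1) • (U D j : Torus D) :=
  (lift_U _ j).trans (Algebra.smul_def _ _).symm

theorem char_add (z : Fin d → Circle) (x y : Fin d → ℤ) :
    P.char z (x + y) = P.char z x * P.char z y := by
  simp only [char, map_add, Finsupp.add_apply, zpow_add, Finset.prod_mul_distrib]

theorem char_p (z : Fin d → Circle) (i : Fin d) : P.char z (P.p i) = z i := by
  rw [char, Finset.prod_eq_single i]
  · simp
  · intro j _ hj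
    simp [Finsupp.single_eq_of_ne hj]
  · simp

/-- `char` as a homomorphism. -/
def charHom (z : Fin d → Circle) : Multiplicative (Fin d → ℤ) →* Circle where
  toFun x := P.char z x.toAdd
  map_one' := by simp [char]
  map_mul' x y := P.char_add z _ _

theorem prod_char (z : Fin d → Circle) (x : Fin d → ℤ) :
    ∏ j, P.char z (Pi.single j 1) ^ x j = P.char z x := by
  have h : ∀ j, P.char z (Pi.single j 1) ^ x j = P.charHom z (.ofAdd (x j • Pi.single j 1)) :=
    fun j => by rw [ofAdd_zsmul, map_zpow]; rfl
  have hx : x = ∑ j, x j • (Pi.single j 1 : Fin d → ℤ) := by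
    ext i
    simp [Finset.sum_apply, Pi.single_apply]
  rw [Finset.prod_congr rfl fun j _ => h j, ← map_prod, ← ofAdd_sum, ← hx]
  rfl

theorem prod_mul {n : ℕ} (c : Fin n → Circle) (u : Fin n → unitary (Torus D)) :
    (List.ofFn fun j => scalar D (c j) * u j).prod
      = scalar D (∏ j, c j) * (List.ofFn u).prod := by
  induction n with
  | zero => simp
  | succ n ih =>
    rw [List.ofFn_succ, List.prod_cons, ih, List.ofFn_succ, List.prod_cons, Fin.prod_univ_succ,
      map_mul, mul_assoc, mul_assoc, ← mul_assoc (u 0), ← mul_assoc (scalar D _) (u 0),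
      (scalar_commute _ (u 0)).eq]

theorem gamma_Ux (z : Fin d → Circle) (x : Fin d → ℤ) :
    P.gamma z (Ux D x) = P.char z x • (Ux D x : Torus D) := by
  have h : Unitary.map (StarMonoidHom.ofClass (P.gamma z)) (Ux D x) = scalar D (P.char z x) * Ux D x := by
    rw [Ux, map_list_prod, List.map_ofFn, ← P.prod_char, ← prod_mul]
    congr 2
    ext1 j
    have : Unitary.map (StarMonoidHom.ofClass (P.gamma z)) (U D j) = scalar D (P.char z (Pi.single j 1)) * U D j :=
      Subtype.ext ((P.gamma_U z j).trans
        (Algebra.smul_def (P.char z (Pi.single j 1) : ℂ) _))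
    rw [Function.comp_apply, map_zpow, this, (scalar_commute _ _).mul_zpow, map_zpow]
  exact (congrArg Subtype.val h).trans (Algebra.smul_def _ _).symm

/-- The defining property of the action `γ'`. -/
theorem gamma_Ux_p (z : Fin d → Circle) (i : Fin d) :
    P.gamma z (Ux D (P.p i)) = z i • (Ux D (P.p i) : Torus D) := by
  rw [gamma_Ux, char_p]

/-- The conditional expectation `E^Λ` obtained by averaging the restriction of `γ'` to `Λ`
over `Λ`. -/
def expect (x : Torus D) : Torus D := ∫ z : P.Lam, P.gamma z x ∂P.haarLam

end AdaptedBasis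

/-! ### State spaces -/

section States

variable (A : Type*) [Ring A] [StarRing A] [Algebra ℂ A] [TopologicalSpace A]

/-- The state space: positive linear functionals `ω` with `ω(1) = 1`, with the weak-* topology. -/
def stateSpace : Set (WeakDual ℂ A) := {ω | (∀ a : A, 0 ≤ ω (star a * a)) ∧ ω 1 = 1}

/-- The space of tracial states, with the weak-* topology. -/
def tracialStateSpace : Set (WeakDual ℂ A) :=
  {τ | τ ∈ stateSpace A ∧ ∀ a b : A, τ (a * b) = τ (b * a)}

end States

/-- An affine map between two (convex) sets of functionals. -/
def IsAffineMap {A B : Type*} [Ring A] [Algebra ℂ A] [TopologicalSpace A]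
    [Ring B] [Algebra ℂ B] [TopologicalSpace B] {S : Set (WeakDual ℂ A)} {T : Set (WeakDual ℂ B)}
    (f : S → T) : Prop :=
  ∀ (ω₁ ω₂ ω : S) (s t : ℝ), 0 ≤ s → 0 ≤ t → s + t = 1 →
    (ω : WeakDual ℂ A) = (s : ℂ) • (ω₁ : WeakDual ℂ A) + (t : ℂ) • (ω₂ : WeakDual ℂ A) →
    (f ω : WeakDual ℂ B) = (s : ℂ) • (f ω₁ : WeakDual ℂ B) + (t : ℂ) • (f ω₂ : WeakDual ℂ B)

/-- The centre of a `*`-algebra, as a `*`-subalgebra. -/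
def centre (A : Type*) [Ring A] [StarRing A] [Algebra ℂ A] [StarModule ℂ A] :
    StarSubalgebra ℂ A where
  __ := Subalgebra.center ℂ A
  star_mem' {_} ha := Set.star_mem_center ha

/-- A conditional expectation of a `C^*`-algebra onto a unital `*`-subalgebra `B`: a positive
contractive `B`-bimodule map which is the identity on `B`. -/
structure IsConditionalExpectation {A : Type*} [CStarAlgebra A] (B : StarSubalgebra ℂ A)
    (E : A →L[ℂ] B) : Prop where
  apply_coe : ∀ b : B, E b = b
  norm_le : ∀ a : A, ‖E a‖ ≤ ‖a‖
  positive : ∀ a : A, ∃ c : A, (E (star a * a) : A) = star c * c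
  bimodule : ∀ (b c : B) (a : A), E (b * a * c) = b * E a * c

end NCTorus

end

open Filter Topology

/-! The scalar multiples of words in the generators span a dense subspace of `Torus D`, so each
bounded operation is determined by its effect on words. Conjugating a word with exponent vector x by
U_y multiplies it by exp(-2πi⟨x, Dy⟩), by `word_comm`. Averaging these inner automorphisms over y in
[0, N)^d therefore multiplies the word by a product of d Cesàro means of powers of points of the
circle. The product tends to 1 if x ∈ H and to 0 if not.

The action of Λ multiplies the same word by a character evaluated at x, and H is exactly the common
kernel of the characters coming from Λ (`char_eq_one_of_mem_H`, `exists_char_ne_one`). Haar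
averaging thus gives the same factor 1 or 0. Both averages are contractive, so `boxAvg D N a`
converges in norm to E^Λ(a) for every a (`tendsto_boxAvg`).

This description of E^Λ as a limit of inner averages yields most of the theorem. Inner averages fix
the centre, are bimodule maps over it, preserve positivity and leave traces invariant; hence so does
E^Λ. Its values are central because words of degree in H are central and all others are killed.
Conversely E^Λ is itself tracial (`expect_mul_comm`), so ω ∘ E^Λ is a tracial state, and restriction
to the centre is the inverse map. -/

/-- The set of points at which a family of `1`-Lipschitz maps converges to a given `1`-Lipschitz
map is closed. -/
theorem isClosed_setOf_tendsto_of_dist_le {ι X Y : Type*} [PseudoMetricSpace X]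
    [PseudoMetricSpace Y] {l : Filter ι} {f : ι → X → Y} {g : X → Y}
    (hf : ∀ i a b, dist (f i a) (f i b) ≤ dist a b) (hg : ∀ a b, dist (g a) (g b) ≤ dist a b) :
    IsClosed {a | Tendsto (fun i => f i a) l (𝓝 (g a))} := by
  refine isClosed_of_closure_subset fun a ha => ?_
  rw [Set.mem_ofPred_eq, Metric.tendsto_nhds]
  intro ε hε
  obtain ⟨b, hb, hab⟩ := Metric.mem_closure_iff.1 ha (ε / 3) (by positivity)
  filter_upwards [Metric.tendsto_nhds.1 hb (ε / 3) (by positivity)] with i hi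
  have h1 := dist_triangle4 (f i a) (f i b) (g b) (g a)
  have h2 := hf i a b
  have h3 := hg b a
  rw [dist_comm b a] at h3
  linarith

/-- The Cesàro means of the powers of `z ≠ 1` on the unit circle tend to `0`. -/
theorem Circle.tendsto_cesaro_pow {z : Circle} (hz : z ≠ 1) :
    Tendsto (fun N : ℕ => (N : ℂ)⁻¹ * ∑ n ∈ Finset.range N, (z : ℂ) ^ n) atTop (𝓝 0) := by
  have hz' : (z : ℂ) ≠ 1 := fun h => hz (Subtype.ext h)
  -- The geometric sums stay bounded uniformly in N, while the prefactor 1/N tends to 0.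
  have hb : ∀ N : ℕ, ‖∑ n ∈ Finset.range N, (z : ℂ) ^ n‖ ≤ 2 / ‖(z : ℂ) - 1‖ := fun N => by
    rw [geom_sum_eq hz', norm_div]
    gcongr
    calc ‖(z : ℂ) ^ N - 1‖ ≤ ‖(z : ℂ) ^ N‖ + ‖(1 : ℂ)‖ := norm_sub_le _ _
      _ = 2 := by simp [Circle.norm_coe]; norm_num
  have h0 : Tendsto (fun N : ℕ => (N : ℂ)⁻¹) atTop (𝓝 0) := tendsto_inv_atTop_nhds_zero_nat
  exact h0.zero_mul_isBoundedUnder_le ⟨_, eventually_map.2 (Eventually.of_forall hb)⟩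

/-! ### Commutation up to a central factor in a group. -/

section Commutation

variable {G : Type*} [Group G] {u v w y z : G}

/-- This and the next three rules say that a central commutation factor is multiplicative in each
argument; they carry relations from generators to words. -/
theorem mul_mul_eq_of_mul_eq_mul (hz : ∀ g, g * z = z * g) (h : u * w = y * (w * u))
    (h' : v * w = z * (w * v)) : u * v * w = y * z * (w * (u * v)) := by
  rw [mul_assoc, h', ← mul_assoc, hz, mul_assoc, ← mul_assoc u, h, ← mul_assoc, ← mul_assoc,
    ← hz y]
  simp only [mul_assoc]

theorem mul_mul_eq_of_mul_eq_mul' (hz : ∀ g, g * z = z * g) (h : u * v = y * (v * u))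
    (h' : u * w = z * (w * u)) : u * (v * w) = y * z * (v * w * u) := by
  rw [← mul_assoc, h, mul_assoc, mul_assoc, h', ← mul_assoc v, hz]
  simp only [mul_assoc]

theorem inv_mul_eq_of_mul_eq_mul (hz : ∀ g, g * z = z * g) (h : u * w = z * (w * u)) :
    u⁻¹ * w = z⁻¹ * (w * u⁻¹) := by
  rw [eq_inv_mul_iff_mul_eq, ← mul_assoc, ← hz, mul_assoc, inv_mul_eq_iff_eq_mul, ← mul_assoc,
    eq_mul_inv_iff_mul_eq, mul_assoc, h]

theorem mul_inv_eq_of_mul_eq_mul (hz : ∀ g, g * z = z * g) (h : u * w = z * (w * u)) :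
    u * w⁻¹ = z⁻¹ * (w⁻¹ * u) := by
  rw [mul_inv_eq_iff_eq_mul, eq_comm, mul_assoc, inv_mul_eq_iff_eq_mul, mul_assoc,
    inv_mul_eq_iff_eq_mul, h, ← mul_assoc, ← mul_assoc, hz]

end Commutation

namespace NCTorus

open FreeStarAlg Torus

/-! ### The bicharacter of D and its left radical H. -/

section Bicharacter

variable {d : ℕ} (D : Matrix (Fin d) (Fin d) ℝ)

/-- The bicharacter `(x, y) ↦ exp(-2πi ⟨x, Dy⟩)` of `ℤ^d`. -/
noncomputable def bichar (x y : Fin d → ℤ) : Circle :=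
  Circle.exp (-(2 * Real.pi) * ((fun i => (x i : ℝ)) ⬝ᵥ D.mulVec fun i => (y i : ℝ)))

theorem bichar_add_left (x x' y : Fin d → ℤ) :
    bichar D (x + x') y = bichar D x y * bichar D x' y := by
  rw [bichar, bichar, bichar, ← Circle.exp_add, ← mul_add, ← add_dotProduct]
  congr 3
  ext i
  simp

theorem bichar_add_right (x y y' : Fin d → ℤ) :
    bichar D x (y + y') = bichar D x y * bichar D x y' := by
  rw [bichar, bichar, bichar, ← Circle.exp_add, ← mul_add, ← dotProduct_add, ← Matrix.mulVec_add]
  congr 4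
  ext i
  simp

theorem bichar_zero_left (y : Fin d → ℤ) : bichar D 0 y = 1 := by
  simpa using bichar_add_left D 0 0 y

theorem bichar_zero_right (x : Fin d → ℤ) : bichar D x 0 = 1 := by
  simpa using bichar_add_right D x 0 0

theorem bichar_neg_left (x y : Fin d → ℤ) : bichar D (-x) y = (bichar D x y)⁻¹ := by
  rw [eq_inv_iff_mul_eq_one, ← bichar_add_left, neg_add_cancel, bichar_zero_left]

theorem bichar_neg_right (x y : Fin d → ℤ) : bichar D x (-y) = (bichar D x y)⁻¹ := by
  rw [eq_inv_iff_mul_eq_one, ← bichar_add_right, neg_add_cancel, bichar_zero_right]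

theorem bichar_single (j k : Fin d) :
    (bichar D (Pi.single j 1) (Pi.single k 1) : ℂ) = phase D j k := by
  have h : ∀ j : Fin d, (fun i => (((Pi.single j 1 : Fin d → ℤ) i : ℤ) : ℝ)) = Pi.single j 1 :=
    fun j => by ext i; by_cases hi : i = j <;> simp [hi]
  rw [bichar, phase, h, h, Circle.coe_exp, Matrix.mulVec_single_one, single_one_dotProduct]
  congr 1
  simp only [Matrix.col_apply]
  push_cast
  ring

theorem bichar_sum_right {ι : Type*} (s : Finset ι) (x : Fin d → ℤ) (y : ι → Fin d → ℤ) :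
    bichar D x (∑ i ∈ s, y i) = ∏ i ∈ s, bichar D x (y i) := by
  classical
  induction s using Finset.induction_on with
  | empty => simp [bichar_zero_right]
  | insert i s hi ih => rw [Finset.sum_insert hi, Finset.prod_insert hi, bichar_add_right, ih]

theorem bichar_nsmul_right (n : ℕ) (x y : Fin d → ℤ) :
    bichar D x (n • y) = bichar D x y ^ n := by
  simpa using bichar_sum_right D (Finset.range n) x fun _ => y

theorem bichar_natCast_right (x : Fin d → ℤ) (y : Fin d → ℕ) :
    bichar D x (fun k => (y k : ℤ)) = ∏ k, bichar D x (Pi.single k 1) ^ y k := by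
  have hy : (fun k => (y k : ℤ)) = ∑ k, y k • (Pi.single k 1 : Fin d → ℤ) := by
    ext i
    simp [Finset.sum_apply, Pi.single_apply]
  simp only [hy, bichar_sum_right, bichar_nsmul_right]

variable {D}

theorem bichar_eq_one_iff (x y : Fin d → ℤ) : bichar D x y = 1 ↔
    ∃ n : ℤ, (fun i => (x i : ℝ)) ⬝ᵥ D.mulVec (fun i => (y i : ℝ)) = n := by
  have hpi : (2 * Real.pi) ≠ 0 := by positivity
  rw [bichar, Circle.exp_eq_one]
  constructor
  · rintro ⟨n, hn⟩
    -- The sign undoes the minus in the exponent -2πi⟨x, Dy⟩.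
    refine ⟨-n, mul_left_cancel₀ hpi ?_⟩
    push_cast
    linarith
  · rintro ⟨n, hn⟩
    refine ⟨-n, ?_⟩
    rw [hn]
    push_cast
    ring

theorem mem_H_iff_bichar {x : Fin d → ℤ} : x ∈ H D ↔ ∀ y, bichar D x y = 1 :=
  forall_congr' fun y => (bichar_eq_one_iff x y).symm

/-- A character of ℤ^d that is trivial on the standard basis is trivial. Having a single bad
coordinate k makes one Cesàro factor vanish in the limit. -/
theorem exists_bichar_single_ne_one {x : Fin d → ℤ} (hx : x ∉ H D) :
    ∃ k, bichar D x (Pi.single k 1) ≠ 1 := by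
  by_contra! h
  refine hx (mem_H_iff_bichar.2 fun y => ?_)
  have hy : y = ∑ k, Pi.single k (y k) := (Finset.univ_sum_single y).symm
  have hs : ∀ n : ℕ, ∀ k, bichar D x (Pi.single k (n : ℤ)) = 1 := fun n k => by
    have : (Pi.single k (n : ℤ) : Fin d → ℤ) = n • Pi.single k 1 := by
      rw [← Pi.single_smul]; simp
    rw [this, bichar_nsmul_right, h, one_pow]
  rw [hy, bichar_sum_right]
  refine Finset.prod_eq_one fun k _ => ?_
  obtain ⟨n, hn | hn⟩ := (y k).eq_nat_or_neg
  · rw [hn, hs]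
  · rw [hn, Pi.single_neg, bichar_neg_right, hs, inv_one]

end Bicharacter

/-! ### Words in the generators and their commutation relation. -/

namespace Torus

variable {d : ℕ} (D : Matrix (Fin d) (Fin d) ℝ)

/-- The unitary of `𝒜_D` given by a word in the generators. -/
noncomputable def word : FreeGroup (Fin d) →* unitary (Torus D) := FreeGroup.lift (U D)

variable {D}

theorem coe_word (w : FreeGroup (Fin d)) : (word D w : Torus D) = of D (mono w 1) := by
  induction w using FreeGroup.induction_on with
  | C1 => rw [map_one, mono_one, map_one]; rfl
  | of j => rw [word, FreeGroup.lift_apply_of]; rfl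
  | inv_of j h =>
    rw [map_inv]
    change star (word D (FreeGroup.of j) : Torus D) = _
    change (word D (FreeGroup.of j) : Torus D) = _ at h
    rw [h, star_of, star_mono, map_one]
  | mul v w hv hw =>
    rw [map_mul, Submonoid.coe_mul, hv, hw, ← map_mul, mono_mul, one_mul]

/-- To prove a closed additive property of elements of `𝒜_D` it suffices to prove it for scalar
multiples of words in the generators. -/
theorem word_induct {motive : Torus D → Prop} (x : Torus D) (closed : IsClosed {x | motive x})
    (add : ∀ x y, motive x → motive y → motive (x + y))
    (smul_word : ∀ (c : ℂ) w, motive (c • (word D w : Torus D))) : motive x := by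
  induction x using Torus.induct with
  | hc => exact closed
  | h x =>
    induction x using FreeStarAlg.induct with
    | mono w c =>
      have h : (mono w c : FreeStarAlg d) = c • mono w 1 := by rw [smul_mono, mul_one]
      rw [h, of_smul, ← coe_word]
      exact smul_word c w
    | add x y hx hy =>
      rw [map_add]
      exact add _ _ hx hy

theorem scalar_mul (c : Circle) (u : unitary (Torus D)) :
    ((scalar D c * u : unitary (Torus D)) : Torus D) = (c : ℂ) • (u : Torus D) :=
  (Algebra.smul_def _ _).symm

/-- The exponent vector of a word. -/
def expo : FreeGroup (Fin d) →* Multiplicative (Fin d → ℤ) :=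
  FreeGroup.lift fun j => .ofAdd (Pi.single j 1)

theorem expo_of (j : Fin d) : expo (FreeGroup.of j) = .ofAdd (Pi.single j 1) :=
  FreeGroup.lift_apply_of

/-- The ordered monomial is literally a word, so facts about words apply to it without a reordering
scalar. -/
theorem exists_word_eq_Ux (x : Fin d → ℤ) :
    ∃ w, (word D w) = Ux D x ∧ (expo w).toAdd = x := by
  refine ⟨(List.ofFn fun j => FreeGroup.of j ^ x j).prod, ?_, ?_⟩
  · rw [map_list_prod, List.map_ofFn, Ux]
    congr 2
    ext1 j
    rw [Function.comp_apply, map_zpow, word, FreeGroup.lift_apply_of]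
  · rw [map_list_prod, List.map_ofFn, List.prod_ofFn, toAdd_prod]
    ext i
    simp [Finset.sum_apply, Pi.single_apply, expo_of]

theorem word_of_comm (j k : Fin d) :
    word D (FreeGroup.of j) * word D (FreeGroup.of k)
      = scalar D (bichar D (Pi.single j 1) (Pi.single k 1)) *
        (word D (FreeGroup.of k) * word D (FreeGroup.of j)) := by
  refine Subtype.ext ?_
  rw [scalar_mul, bichar_single, word, FreeGroup.lift_apply_of, FreeGroup.lift_apply_of]
  exact U_mul_U D j k

/-- The commutation relation between words. -/
theorem word_comm (v w : FreeGroup (Fin d)) :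
    word D v * word D w
      = scalar D (bichar D (expo v).toAdd (expo w).toAdd) * (word D w * word D v) := by
  have hs : ∀ c u, u * scalar D c = scalar D c * u := fun c u => (scalar_commute c u).eq.symm
  -- Both sides are multiplicative in v and in w: the induction on v is done against a single
  -- generator, and this is the base of the induction on w.
  have left : ∀ k, word D v * word D (FreeGroup.of k)
      = scalar D (bichar D (expo v).toAdd (Pi.single k 1)) *
        (word D (FreeGroup.of k) * word D v) := by
    intro k
    induction v using FreeGroup.induction_on with
    | C1 => rw [map_one, map_one, toAdd_one, bichar_zero_left, map_one, one_mul, one_mul, mul_one]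
    | of j => rw [expo_of]; exact word_of_comm j k
    | inv_of j h =>
      have h' := inv_mul_eq_of_mul_eq_mul (hs _) h
      rw [← map_inv (word D), ← map_inv (scalar D), ← bichar_neg_left, ← toAdd_inv,
        ← map_inv expo] at h'
      exact h'
    | mul v v' h h' =>
      rw [map_mul (word D), map_mul expo, toAdd_mul, bichar_add_left, map_mul (scalar D)]
      exact mul_mul_eq_of_mul_eq_mul (hs _) h h'
  induction w using FreeGroup.induction_on with
  | C1 => rw [map_one, map_one, toAdd_one, bichar_zero_right, map_one, one_mul, one_mul, mul_one]
  | of k => rw [expo_of]; exact left k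
  | inv_of k h =>
    have h' := mul_inv_eq_of_mul_eq_mul (hs _) h
    rw [← map_inv (word D), ← map_inv (scalar D), ← bichar_neg_right, ← toAdd_inv,
      ← map_inv expo] at h'
    exact h'
  | mul w w' h h' =>
    rw [map_mul (word D), map_mul expo, toAdd_mul, bichar_add_right, map_mul (scalar D)]
    exact mul_mul_eq_of_mul_eq_mul' (hs _) h h'

end Torus

open MeasureTheory

variable {d : ℕ} {D : Matrix (Fin d) (Fin d) ℝ}

/-! ### The action on words and its continuity. -/

namespace AdaptedBasis

variable (P : AdaptedBasis D)

/-- Both sides are multiplicative in the word because scalars are central, so the generators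
suffice. The eigenvalue depends only on the exponent vector. -/
theorem gamma_word (z : Fin d → Circle) (w : FreeGroup (Fin d)) :
    P.gamma z (word D w) = (P.char z (expo w).toAdd : ℂ) • (word D w : Torus D) := by
  have h : (Unitary.map (StarMonoidHom.ofClass (P.gamma z))) (word D w)
      = scalar D (P.charHom z (expo w)) * word D w := by
    induction w using FreeGroup.induction_on with
    | C1 => simp only [map_one, one_mul]
    | of j =>
      refine Subtype.ext ?_
      rw [scalar_mul, expo_of, word, FreeGroup.lift_apply_of]
      exact P.gamma_U z j
    | inv_of j h =>
      change Unitary.map _ (word D (FreeGroup.of j)) = scalar D (P.charHom z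
        (expo (FreeGroup.of j))) * word D (FreeGroup.of j) at h
      rw [map_inv (word D), map_inv, h, mul_inv_rev, map_inv expo, map_inv (P.charHom z),
        map_inv (scalar D), ← map_inv (scalar D), (scalar_commute _ _).eq]
    | mul v w hv hw =>
      rw [map_mul (word D), map_mul, hv, hw, map_mul expo, map_mul (P.charHom z),
        map_mul (scalar D), mul_assoc, mul_assoc, ← mul_assoc (word D v),
        ← (scalar_commute _ (word D v)).eq, mul_assoc]
  exact (congrArg Subtype.val h).trans (scalar_mul _ _)

theorem norm_gamma_le (z : Fin d → Circle) (x : Torus D) : ‖P.gamma z x‖ ≤ ‖x‖ :=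
  NonUnitalStarAlgHom.norm_apply_le (P.gamma z) x

theorem continuous_char (x : Fin d → ℤ) : Continuous fun z => P.char z x :=
  continuous_finsetProd _ fun i _ => (continuous_apply i).zpow _

/-- Each automorphism is contractive, which reduces the claim to words, where only a continuous
scalar varies. Continuity on compact Λ gives integrability of the orbit maps. -/
theorem continuous_gamma (x : Torus D) : Continuous fun z => P.gamma z x := by
  rw [continuous_iff_continuousAt]
  intro z
  have hdist : ∀ z (a b : Torus D), dist (P.gamma z a) (P.gamma z b) ≤ dist a b := fun z a b => by
    rw [dist_eq_norm, dist_eq_norm, ← map_sub]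
    exact P.norm_gamma_le z _
  change Tendsto _ _ _
  induction x using word_induct with
  | closed => exact isClosed_setOf_tendsto_of_dist_le hdist (hdist z)
  | add x y hx hy => simpa only [map_add] using hx.add hy
  | smul_word c w =>
    simp only [map_smul, gamma_word]
    have h : Continuous fun z => (P.char z (expo w).toAdd : ℂ) :=
      continuous_subtype_val.comp (P.continuous_char _)
    exact (((h.tendsto z).smul_const _).const_smul c)

/-! ### Duality between Λ and H. -/

theorem char_zero (z : Fin d → Circle) : P.char z 0 = 1 := by simp [char]

theorem char_mul (z z' : Fin d → Circle) (x : Fin d → ℤ) :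
    P.char (z * z') x = P.char z x * P.char z' x := by
  simp only [char, Pi.mul_apply, mul_zpow, Finset.prod_mul_distrib]

theorem char_eq_one_of_mem_H {z : Fin d → Circle} (hz : z ∈ P.Lam) {x : Fin d → ℤ} (hx : x ∈ H D) :
    P.char z x = 1 := by
  rw [← P.span_eq] at hx
  induction hx using Submodule.span_induction with
  | mem x hx =>
    obtain ⟨i, rfl⟩ := hx
    have h := map_zpow (P.charHom z) (.ofAdd (P.p (Fin.castLE P.m_le i))) (P.a i : ℤ)
    rw [← ofAdd_zsmul] at h
    refine h.trans ?_
    change P.char z (P.p _) ^ _ = 1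
    rw [char_p, zpow_natCast]
    exact hz i
  | zero => exact P.char_zero z
  | add x y _ _ hx hy => rw [char_add, hx, hy, one_mul]
  | smul n x _ hx =>
    have h := map_zpow (P.charHom z) (.ofAdd x) n
    rw [← ofAdd_zsmul] at h
    refine h.trans ?_
    change P.char z x ^ n = 1
    rw [hx, one_zpow]

theorem char_mulSingle (j : Fin d) (c : Circle) (x : Fin d → ℤ) :
    P.char (Pi.mulSingle j c) x = c ^ P.p.repr x j := by
  rw [char, Finset.prod_eq_single j]
  · simp
  · intro i _ hi
    rw [Pi.mulSingle_eq_of_ne hi, one_zpow]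
  · simp

/-- For `n ≥ 1` there is a point of the circle whose annihilator in `ℤ` is `nℤ`. -/
theorem exists_circle_zpow_eq_one_iff {n : ℕ} (hn : 0 < n) :
    ∃ c : Circle, ∀ k : ℤ, c ^ k = 1 ↔ (n : ℤ) ∣ k := by
  have hn' : (n : ℝ) ≠ 0 := by positivity
  refine ⟨Circle.exp (2 * Real.pi / n), fun k => ?_⟩
  rw [← Circle.exp_zsmul, Circle.exp_eq_one]
  refine exists_congr fun l => ?_
  rw [← @Int.cast_inj ℝ, zsmul_eq_mul]
  push_cast
  field_simp

/-- Elements of Λ supported in one coordinate already detect H: an element of exact order a_i forces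
a_i to divide the i-th coordinate of x for i ≤ m, and the unrestricted circle factors force the
remaining coordinates to vanish. -/
theorem exists_char_ne_one {x : Fin d → ℤ} (hx : x ∉ H D) : ∃ z ∈ P.Lam, P.char z x ≠ 1 := by
  by_contra! h
  have hlt : ∀ i : Fin P.m, (P.a i : ℤ) ∣ P.p.repr x (Fin.castLE P.m_le i) := fun i => by
    obtain ⟨c, hc⟩ := exists_circle_zpow_eq_one_iff (P.a_pos i)
    rw [← hc, ← char_mulSingle]
    refine h _ fun j => ?_
    rcases eq_or_ne j i with rfl | hj
    · rw [Pi.mulSingle_eq_same, ← zpow_natCast, hc]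
    · rw [Pi.mulSingle_eq_of_ne fun h => hj (Fin.castLE_injective P.m_le h), one_pow]
  have hge : ∀ j : Fin d, j ∉ Set.range (Fin.castLE P.m_le) → P.p.repr x j = 0 := fun j hj => by
    by_contra h0
    -- An order of twice the absolute value of the nonzero coordinate cannot divide that coordinate.
    obtain ⟨c, hc⟩ := exists_circle_zpow_eq_one_iff
      (n := 2 * (P.p.repr x j).natAbs) (by positivity)
    have h1 : c ^ P.p.repr x j = 1 := by
      rw [← char_mulSingle]
      refine h _ fun i => ?_
      rw [Pi.mulSingle_eq_of_ne fun h => hj ⟨i, h⟩, one_pow]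
    have h2 := Int.natAbs_le_of_dvd_ne_zero ((hc _).1 h1) h0
    omega
  refine hx ?_
  rw [← P.p.sum_repr x, ← P.span_eq]
  refine Submodule.sum_mem _ fun j _ => ?_
  by_cases hj : j ∈ Set.range (Fin.castLE P.m_le)
  · obtain ⟨i, rfl⟩ := hj
    obtain ⟨k, hk⟩ := hlt i
    rw [hk, mul_comm, mul_smul]
    exact Submodule.smul_mem _ _ (Submodule.subset_span ⟨i, rfl⟩)
  · rw [hge j hj, zero_smul]
    exact zero_mem _

/-! ### The Haar average over Λ. -/

noncomputable instance : IsProbabilityMeasure P.haarLam :=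
  ⟨by simpa [haarLam] using Measure.haarMeasure_self (K₀ := (⊤ : TopologicalSpace.PositiveCompacts P.Lam))⟩

instance : P.haarLam.IsMulLeftInvariant := by
  unfold haarLam
  infer_instance

theorem continuous_gamma_Lam (x : Torus D) : Continuous fun z : P.Lam => P.gamma z x :=
  (P.continuous_gamma x).comp continuous_subtype_val

theorem integrable_gamma (x : Torus D) : Integrable (fun z : P.Lam => P.gamma z x) P.haarLam :=
  (P.continuous_gamma_Lam x).integrable_of_hasCompactSupport (HasCompactSupport.of_compactSpace _)

theorem expect_add (x y : Torus D) : P.expect (x + y) = P.expect x + P.expect y := by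
  simp only [expect, map_add]
  exact integral_add (P.integrable_gamma x) (P.integrable_gamma y)

theorem expect_smul (c : ℂ) (x : Torus D) : P.expect (c • x) = c • P.expect x := by
  simp only [expect, map_smul]
  exact integral_smul c _

theorem norm_expect_le (x : Torus D) : ‖P.expect x‖ ≤ ‖x‖ := by
  refine (norm_integral_le_of_norm_le_const (μ := P.haarLam)
    (Eventually.of_forall fun z : P.Lam => P.norm_gamma_le z x)).trans_eq ?_
  rw [probReal_univ, mul_one]

theorem dist_expect_le (x y : Torus D) : dist (P.expect x) (P.expect y) ≤ dist x y := by
  have h : P.expect x - P.expect y = P.expect (x - y) := by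
    simpa [sub_eq_add_neg, expect_add] using (P.expect_smul (-1) y).symm
  rw [dist_eq_norm, dist_eq_norm, h]
  exact P.norm_expect_le _

theorem continuous_expect : Continuous P.expect :=
  (LipschitzWith.of_dist_le' (K := 1) fun x y => by simpa using P.dist_expect_le x y).continuous

/-- Translating by an element of Λ whose character is nontrivial at x multiplies the integral by a
factor other than 1, but Haar measure is invariant. -/
theorem integral_char_of_notMem {x : Fin d → ℤ} (hx : x ∉ H D) :
    ∫ z : P.Lam, (P.char z x : ℂ) ∂P.haarLam = 0 := by
  obtain ⟨z, hz, hzx⟩ := P.exists_char_ne_one hx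
  have h := integral_mul_left_eq_self (μ := P.haarLam) (fun z : P.Lam => (P.char z x : ℂ)) ⟨z, hz⟩
  simp only [Subgroup.coe_mul, char_mul, Circle.coe_mul, integral_const_mul] at h
  by_contra h0
  exact hzx (Subtype.ext (mul_right_cancel₀ h0 (h.trans (one_mul _).symm)))

theorem expect_word (w : FreeGroup (Fin d)) : P.expect (word D w)
    = (∫ z : P.Lam, (P.char z (expo w).toAdd : ℂ) ∂P.haarLam) • (word D w : Torus D) := by
  simp only [expect, gamma_word]
  exact integral_smul_const _ _

theorem expect_word_of_mem {w : FreeGroup (Fin d)} (hw : (expo w).toAdd ∈ H D) :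
    P.expect (word D w) = word D w := by
  have h : ∀ z : P.Lam, P.char z (expo w).toAdd = 1 := fun z => P.char_eq_one_of_mem_H z.2 hw
  rw [expect_word]
  simp [h]

theorem expect_word_of_notMem {w : FreeGroup (Fin d)} (hw : (expo w).toAdd ∉ H D) :
    P.expect (word D w) = 0 := by
  rw [expect_word, P.integral_char_of_notMem hw, zero_smul]

end AdaptedBasis

/-! ### Inner automorphisms, traces and box averages. -/

namespace Torus

theorem star_mul_word_mul (v w : FreeGroup (Fin d)) :
    star (word D w : Torus D) * word D v * word D w
      = (bichar D (expo v).toAdd (expo w).toAdd : ℂ) • (word D v : Torus D) := by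
  have h : (word D w)⁻¹ * word D v * word D w
      = scalar D (bichar D (expo v).toAdd (expo w).toAdd) * word D v := by
    rw [mul_assoc, word_comm, ← mul_assoc, ← (scalar_commute _ _).eq, mul_assoc,
      inv_mul_cancel_left]
  exact (congrArg Subtype.val h).trans (scalar_mul _ _)

theorem star_Ux_mul_word_mul_Ux (v : FreeGroup (Fin d)) (y : Fin d → ℤ) :
    star (Ux D y : Torus D) * word D v * Ux D y
      = (bichar D (expo v).toAdd y : ℂ) • (word D v : Torus D) := by
  obtain ⟨w, hw, rfl⟩ := exists_word_eq_Ux (D := D) y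
  rw [← hw, star_mul_word_mul]

/-- A trace vanishes on `U_b` for `b ∉ H`. -/
theorem map_Ux_eq_zero_of_notMem {τ : Torus D →ₗ[ℂ] ℂ} (hτ : ∀ x y, τ (x * y) = τ (y * x))
    {b : Fin d → ℤ} (hb : b ∉ H D) : τ (Ux D b) = 0 := by
  obtain ⟨w, hw, rfl⟩ := exists_word_eq_Ux (D := D) b
  obtain ⟨k, hk⟩ := exists_bichar_single_ne_one hb
  -- Cyclicity makes τ invariant under conjugation by a unitary, yet here conjugation scales U_b by
  -- a number other than 1. This is purely algebraic, so τ need not be continuous.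
  have h := congrArg τ (star_Ux_mul_word_mul_Ux (D := D) w (Pi.single k 1))
  rw [hτ, ← mul_assoc, Unitary.mul_star_self_of_mem (Ux D _).2, one_mul, map_smul, hw,
    smul_eq_mul] at h
  by_contra h0
  exact hk (Subtype.ext (mul_right_cancel₀ h0 (h.symm.trans (one_mul _).symm)))

variable (D) in
/-- The average of the inner automorphisms `Ad U_y^*` over the box `[0, N)^d`. -/
noncomputable def boxAvg (N : ℕ) : Torus D →ₗ[ℂ] Torus D :=
  ((N : ℂ) ^ d)⁻¹ • ∑ y ∈ Fintype.piFinset fun _ : Fin d => Finset.range N,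
    (LinearMap.mulLeft ℂ (star (Ux D fun k => (y k : ℤ)) : Torus D)).comp
      (LinearMap.mulRight ℂ (Ux D fun k => (y k : ℤ) : Torus D))

theorem boxAvg_apply (N : ℕ) (a : Torus D) : boxAvg D N a =
    ((N : ℂ) ^ d)⁻¹ • ∑ y ∈ Fintype.piFinset fun _ : Fin d => Finset.range N,
      star (Ux D fun k => (y k : ℤ) : Torus D) * a * Ux D fun k => (y k : ℤ) := by
  simp [boxAvg, LinearMap.sum_apply, mul_assoc]

theorem card_box (N : ℕ) :
    (Fintype.piFinset fun _ : Fin d => Finset.range N).card = N ^ d := by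
  simp

theorem norm_unitary_conj_le (u : unitary (Torus D)) (a : Torus D) :
    ‖star (u : Torus D) * a * u‖ ≤ ‖a‖ := by
  rw [CStarRing.norm_mul_coe_unitary, ← Unitary.coe_star, CStarRing.norm_coe_unitary_mul]

theorem norm_boxAvg_le (N : ℕ) (a : Torus D) : ‖boxAvg D N a‖ ≤ ‖a‖ := by
  rw [boxAvg_apply, norm_smul]
  have h := norm_sum_le_of_le (Fintype.piFinset fun _ : Fin d => Finset.range N)
    (f := fun y => star (Ux D fun k => (y k : ℤ) : Torus D) * a * Ux D fun k => (y k : ℤ))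
    fun y _ => norm_unitary_conj_le _ a
  rw [Finset.sum_const, card_box, nsmul_eq_mul] at h
  refine (mul_le_mul_of_nonneg_left h (norm_nonneg _)).trans ?_
  rw [← mul_assoc]
  refine mul_le_of_le_one_left (norm_nonneg _) ?_
  rw [norm_inv, norm_pow, Complex.norm_natCast, Nat.cast_pow]
  -- An inequality suffices, and it also covers a zero denominator, where the inverse is 0.
  exact inv_mul_le_one

/-- The target is kept general to cover both the identity map (central elements) and a trace. -/
theorem boxAvg_eq_self {N : ℕ} (hN : N ≠ 0) {M : Type*} [AddCommGroup M] [Module ℂ M]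
    (f : Torus D →ₗ[ℂ] M) {a : Torus D}
    (h : ∀ u : unitary (Torus D), f (star (u : Torus D) * a * u) = f a) :
    f (boxAvg D N a) = f a := by
  rw [boxAvg_apply, map_smul, map_sum, Finset.sum_congr rfl fun y _ => h _, Finset.sum_const,
    card_box, ← Nat.cast_smul_eq_nsmul ℂ, smul_smul, Nat.cast_pow, inv_mul_cancel₀, one_smul]
  exact pow_ne_zero _ (Nat.cast_ne_zero.2 hN)

/-- The bicharacter is multiplicative in y, so its sum over the box factors into one geometric sum
per coordinate. -/
theorem boxAvg_word (N : ℕ) (w : FreeGroup (Fin d)) : boxAvg D N (word D w) =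
    (∏ k, ((N : ℂ)⁻¹ * ∑ n ∈ Finset.range N,
      (bichar D (expo w).toAdd (Pi.single k 1) : ℂ) ^ n)) • (word D w : Torus D) := by
  rw [boxAvg_apply, Finset.prod_mul_distrib, Finset.prod_univ_sum, Finset.prod_const,
    Finset.card_univ, Fintype.card_fin, inv_pow, mul_smul, Finset.sum_smul]
  congr 1
  refine Finset.sum_congr rfl fun y _ => ?_
  rw [star_Ux_mul_word_mul_Ux, bichar_natCast_right]
  congr 1
  exact (map_prod Circle.coeHom _ _).trans (Finset.prod_congr rfl fun k _ => map_pow Circle.coeHom _ _)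

end Torus

/-! ### Convergence of box averages to E^Λ and its consequences. -/

namespace AdaptedBasis

variable (P : AdaptedBasis D)

theorem tendsto_boxAvg (a : Torus D) :
    Tendsto (fun N => boxAvg D N a) atTop (𝓝 (P.expect a)) := by
  classical
  have hdist : ∀ N (a b : Torus D), dist (boxAvg D N a) (boxAvg D N b) ≤ dist a b :=
    fun N a b => by
      rw [dist_eq_norm, dist_eq_norm, ← map_sub]
      exact norm_boxAvg_le N _
  induction a using word_induct with
  | closed => exact isClosed_setOf_tendsto_of_dist_le hdist P.dist_expect_le
  | add x y hx hy => simpa only [map_add, expect_add] using hx.add hy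
  | smul_word c w =>
    simp only [map_smul, expect_smul]
    refine Tendsto.const_smul ?_ c
    have hlim : ∀ k, Tendsto (fun N : ℕ => (N : ℂ)⁻¹ * ∑ n ∈ Finset.range N,
        (bichar D (expo w).toAdd (Pi.single k 1) : ℂ) ^ n) atTop
        (𝓝 (if bichar D (expo w).toAdd (Pi.single k 1) = 1 then 1 else 0)) := fun k => by
      split_ifs with h
      · refine tendsto_const_nhds.congr' ?_
        -- The mean of the constant 1 is 1 except at N = 0, where it is 0.
        filter_upwards [eventually_ne_atTop 0] with N hN
        have hN' : (N : ℂ) ≠ 0 := Nat.cast_ne_zero.2 hN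
        simp [h, hN']
      · exact Circle.tendsto_cesaro_pow h
    have hprod := (tendsto_finsetProd Finset.univ fun k _ => hlim k).smul_const
      (word D w : Torus D)
    simp only [boxAvg_word]
    convert hprod using 2
    -- The limit is a product of indicators, equal to 1 exactly on H, which is also the factor
    -- produced by E^Λ.
    by_cases hw : (expo w).toAdd ∈ H D
    · rw [P.expect_word_of_mem hw]
      simp [mem_H_iff_bichar.1 hw]
    · obtain ⟨k, hk⟩ := exists_bichar_single_ne_one hw
      rw [P.expect_word_of_notMem hw, Finset.prod_eq_zero (Finset.mem_univ k) (if_neg hk),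
        zero_smul]

theorem expect_of_mem_centre {a : Torus D} (ha : a ∈ centre (Torus D)) : P.expect a = a := by
  refine tendsto_nhds_unique (P.tendsto_boxAvg a) (tendsto_const_nhds.congr' ?_)
  filter_upwards [eventually_ne_atTop 0] with N hN
  refine (boxAvg_eq_self hN LinearMap.id fun u => ?_).symm
  have ha' := Subalgebra.mem_center_iff.1 ha
  rw [LinearMap.id_apply, LinearMap.id_apply, ha', mul_assoc, Unitary.star_mul_self_of_mem u.2,
    mul_one]

theorem map_expect_of_trace (τ : Torus D →L[ℂ] ℂ) (hτ : ∀ x y, τ (x * y) = τ (y * x))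
    (a : Torus D) : τ (P.expect a) = τ a := by
  refine tendsto_nhds_unique ((τ.continuous.tendsto _).comp (P.tendsto_boxAvg a))
    (tendsto_const_nhds.congr' ?_)
  filter_upwards [eventually_ne_atTop 0] with N hN
  refine (boxAvg_eq_self hN τ.toLinearMap fun u => ?_).symm
  change τ _ = τ _
  rw [hτ, ← mul_assoc, Unitary.mul_star_self_of_mem u.2, one_mul]

/-- Central factors pass through every conjugation, hence through the box averages and their limit.
-/
theorem expect_bimodule {b c : Torus D} (hb : b ∈ centre (Torus D)) (hc : c ∈ centre (Torus D))
    (a : Torus D) : P.expect (b * a * c) = b * P.expect a * c := by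
  refine tendsto_nhds_unique (P.tendsto_boxAvg _)
    ((((P.tendsto_boxAvg a).const_mul b).mul_const c).congr fun N => ?_)
  rw [boxAvg_apply, boxAvg_apply, mul_smul_comm, smul_mul_assoc, Finset.mul_sum, Finset.sum_mul]
  refine congrArg _ (Finset.sum_congr rfl fun y _ => ?_)
  have hb' := Subalgebra.mem_center_iff.1 hb
  have hc' := Subalgebra.mem_center_iff.1 hc
  simp only [mul_assoc]
  rw [← hc', ← mul_assoc b, ← hb' (star _)]
  simp only [mul_assoc]

theorem word_mem_centre {w : FreeGroup (Fin d)} (hw : (expo w).toAdd ∈ H D) :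
    (word D w : Torus D) ∈ centre (Torus D) := by
  refine Subalgebra.mem_center_iff.2 fun b => ?_
  induction b using word_induct with
  | closed => exact isClosed_eq (by fun_prop) (by fun_prop)
  | add x y hx hy => rw [add_mul, mul_add, hx, hy]
  | smul_word c v =>
    rw [smul_mul_assoc, mul_smul_comm]
    have h := word_comm (D := D) w v
    rw [mem_H_iff_bichar.1 hw, map_one, one_mul] at h
    exact congrArg _ (congrArg Subtype.val h).symm

theorem expect_mem_centre (a : Torus D) : P.expect a ∈ centre (Torus D) := by
  induction a using word_induct with
  | closed =>
    have h : {x | P.expect x ∈ centre (Torus D)} =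
        ⋂ b : Torus D, {x | b * P.expect x = P.expect x * b} := by
      ext x
      rw [Set.mem_iInter]
      exact Subalgebra.mem_center_iff (R := ℂ)
    rw [h]
    have := P.continuous_expect
    exact isClosed_iInter fun b => isClosed_eq (by fun_prop) (by fun_prop)
  | add x y hx hy => rw [expect_add]; exact add_mem hx hy
  | smul_word c w =>
    rw [expect_smul]
    refine SMulMemClass.smul_mem c ?_
    by_cases hw : (expo w).toAdd ∈ H D
    · rw [P.expect_word_of_mem hw]; exact word_mem_centre hw
    · rw [P.expect_word_of_notMem hw]; exact zero_mem _

/-- Conjugation only rescales words; the scale is 1 in degrees from H, and E^Λ kills all other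
degrees. -/
theorem expect_star_word_mul_mul_word (w : FreeGroup (Fin d)) (a : Torus D) :
    P.expect (star (word D w : Torus D) * a * word D w) = P.expect a := by
  have hc := P.continuous_expect
  induction a using word_induct with
  | closed => exact isClosed_eq (by fun_prop) (by fun_prop)
  | add x y hx hy => rw [mul_add, add_mul, expect_add, expect_add, hx, hy]
  | smul_word c v =>
    rw [mul_smul_comm, smul_mul_assoc, expect_smul, expect_smul, star_mul_word_mul, expect_smul]
    by_cases hv : (expo v).toAdd ∈ H D
    · rw [mem_H_iff_bichar.1 hv, Circle.coe_one, one_smul]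
    · rw [P.expect_word_of_notMem hv, smul_zero]

/-- By density b may be a word w, and then a w = w^*(w a) w is a conjugate of w a. -/
theorem expect_mul_comm (a b : Torus D) : P.expect (a * b) = P.expect (b * a) := by
  have hc := P.continuous_expect
  induction b using word_induct with
  | closed => exact isClosed_eq (by fun_prop) (by fun_prop)
  | add x y hx hy => rw [mul_add, add_mul, expect_add, expect_add, hx, hy]
  | smul_word c w =>
    rw [mul_smul_comm, smul_mul_assoc, expect_smul, expect_smul,
      ← P.expect_star_word_mul_mul_word w (word D w * a), ← mul_assoc (star _),
      Unitary.star_mul_self_of_mem (word D w).2, one_mul]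

/-- `E^Λ(a^* a)` is of the form `c^* c` with `c` in the centre. -/
theorem exists_expect_star_mul_self (a : Torus D) :
    ∃ c ∈ centre (Torus D), P.expect (star a * a) = star c * c := by
  let _ : PartialOrder (Torus D) := CStarAlgebra.spectralOrder _
  let _ : StarOrderedRing (Torus D) := CStarAlgebra.spectralOrderedRing _
  -- Box averages of a positive element are positive, and the positive cone is closed.
  have h0 : 0 ≤ P.expect (star a * a) := by
    refine ge_of_tendsto' (P.tendsto_boxAvg _) fun N => ?_
    have hN : ((N : ℂ) ^ d)⁻¹ = (((N : ℝ) ^ d)⁻¹ : ℝ) := by push_cast; rfl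
    rw [boxAvg_apply, hN, Complex.coe_smul]
    refine smul_nonneg (by positivity) (Finset.sum_nonneg fun y _ => ?_)
    exact star_left_conjugate_nonneg (star_mul_self_nonneg a) _
  -- The square root commutes with whatever commutes with E^Λ(a^* a), so it is central. This is
  -- needed because positivity of a state of the centre is tested only on c^* c with c central.
  refine ⟨CFC.sqrt (P.expect (star a * a)), Subalgebra.mem_center_iff.2 fun b => ?_, ?_⟩
  · have hcomm : Commute (P.expect (star a * a)) b :=
      (Subalgebra.mem_center_iff.1 (P.expect_mem_centre (star a * a)) b).symm
    exact (hcomm.cfcₙ_nnreal _).symm.eq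
  · rw [(IsSelfAdjoint.of_nonneg (CFC.sqrt_nonneg (P.expect (star a * a)))).star_eq,
      CFC.sqrt_mul_sqrt_self _ h0]

/-- `E^Λ` as a continuous linear map onto the centre. -/
noncomputable def expectCLM : Torus D →L[ℂ] centre (Torus D) :=
  LinearMap.mkContinuous
    { toFun := fun a => ⟨P.expect a, P.expect_mem_centre a⟩
      map_add' := fun a b => Subtype.ext (P.expect_add a b)
      map_smul' := fun c a => Subtype.ext (P.expect_smul c a) } 1
    fun a => (P.norm_expect_le a).trans_eq (one_mul _).symm

theorem coe_expectCLM (a : Torus D) : (P.expectCLM a : Torus D) = P.expect a := rfl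

theorem expectCLM_coe (b : centre (Torus D)) : P.expectCLM b = b :=
  Subtype.ext (P.expect_of_mem_centre b.2)

theorem isConditionalExpectation_expectCLM :
    IsConditionalExpectation (centre (Torus D)) P.expectCLM where
  apply_coe := P.expectCLM_coe
  norm_le := P.norm_expect_le
  positive a := by
    obtain ⟨c, -, hc⟩ := P.exists_expect_star_mul_self a
    exact ⟨c, hc⟩
  bimodule b c a := Subtype.ext (P.expect_bimodule b.2 c.2 a)

/-! ### States of the centre and tracial states. -/

/-- The tracial state `ω ∘ E^Λ` for a state `ω` of the centre. -/
noncomputable def toTracialState (ω : stateSpace (centre (Torus D))) :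
    tracialStateSpace (Torus D) :=
  ⟨ContinuousLinearMap.comp (ω : WeakDual ℂ (centre (Torus D))) P.expectCLM, by
    refine ⟨⟨fun a => ?_, ?_⟩, fun a b => ?_⟩
    · obtain ⟨c, hc, h⟩ := P.exists_expect_star_mul_self a
      have h' : P.expectCLM (star a * a) = star (⟨c, hc⟩ : centre (Torus D)) * ⟨c, hc⟩ :=
        Subtype.ext h
      change 0 ≤ ω.1 (P.expectCLM (star a * a))
      rw [h']
      exact ω.2.1 _
    · change ω.1 (P.expectCLM 1) = 1
      exact (congrArg ω.1 (P.expectCLM_coe 1)).trans ω.2.2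
    · exact congrArg ω.1 (Subtype.ext (P.expect_mul_comm a b))⟩

theorem toTracialState_apply (ω : stateSpace (centre (Torus D))) (a : Torus D) :
    (P.toTracialState ω : WeakDual ℂ (Torus D)) a
      = (ω : WeakDual ℂ (centre (Torus D))) (P.expectCLM a) := rfl

end AdaptedBasis

variable (D) in
/-- The inclusion of the centre as a continuous linear map. -/
noncomputable def centreInclusion : centre (Torus D) →L[ℂ] Torus D :=
  LinearMap.mkContinuous (centre (Torus D)).subtype.toAlgHom.toLinearMap 1
    fun _ => (one_mul _).ge

/-- The restriction of a tracial state to the centre. -/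
noncomputable def restrictCentre (τ : tracialStateSpace (Torus D)) :
    stateSpace (centre (Torus D)) :=
  ⟨ContinuousLinearMap.comp (τ : WeakDual ℂ (Torus D)) (centreInclusion D),
    fun c => τ.2.1.1 c, τ.2.1.2⟩

/-- `ω ↦ ω ∘ E^Λ` is a homeomorphism of the state space of the centre onto the space of tracial
states; its inverse is restriction. -/
noncomputable def AdaptedBasis.stateHomeomorph (P : AdaptedBasis D) :
    stateSpace (centre (Torus D)) ≃ₜ tracialStateSpace (Torus D) where
  toFun := P.toTracialState
  invFun := restrictCentre
  left_inv ω := Subtype.ext <| ContinuousLinearMap.ext fun c =>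
    congrArg ω.1 (P.expectCLM_coe c)
  right_inv τ := Subtype.ext <| ContinuousLinearMap.ext fun a =>
    P.map_expect_of_trace τ.1 τ.2.2 a
  -- In both directions, evaluating the image at a point is evaluating the source at a fixed point,
  -- so weak* continuity is immediate.
  continuous_toFun := continuous_induced_rng.2 <| WeakDual.continuous_of_continuous_eval fun a =>
    (WeakDual.eval_continuous (P.expectCLM a)).comp continuous_subtype_val
  continuous_invFun := continuous_induced_rng.2 <| WeakDual.continuous_of_continuous_eval fun c =>
    (WeakDual.eval_continuous (c : Torus D)).comp continuous_subtype_val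

theorem AdaptedBasis.isAffineMap_stateHomeomorph (P : AdaptedBasis D) :
    IsAffineMap P.stateHomeomorph := fun _ _ _ _ _ _ _ _ h =>
  ContinuousLinearMap.ext fun a =>
    congrArg (fun f : WeakDual ℂ (centre (Torus D)) => f (P.expectCLM a)) h

end NCTorus

theorem mainTheorem5 (d : ℕ) (D : Matrix (Fin d) (Fin d) ℝ) (hD : D.transpose = -D) :
    (∀ P : NCTorus.AdaptedBasis D,
      ∃ E : NCTorus.Torus D →L[ℂ] NCTorus.centre (NCTorus.Torus D),
        (∀ x : NCTorus.Torus D, (E x : NCTorus.Torus D) = P.expect x) ∧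
        NCTorus.IsConditionalExpectation (NCTorus.centre (NCTorus.Torus D)) E ∧
        ∃ Φ : NCTorus.stateSpace (NCTorus.centre (NCTorus.Torus D)) ≃ₜ
            NCTorus.tracialStateSpace (NCTorus.Torus D),
          (∀ (ω : NCTorus.stateSpace (NCTorus.centre (NCTorus.Torus D))) (x : NCTorus.Torus D),
            (Φ ω : WeakDual ℂ (NCTorus.Torus D)) x =
              (ω : WeakDual ℂ (NCTorus.centre (NCTorus.Torus D))) (E x)) ∧
          NCTorus.IsAffineMap Φ) ∧
    (∀ τ : NCTorus.Torus D →ₗ[ℂ] ℂ, (∀ x y, τ (x * y) = τ (y * x)) →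
      ∀ b : Fin d → ℤ, b ∉ NCTorus.H D → τ (NCTorus.Torus.Ux D b) = 0) :=
  ⟨fun P => ⟨P.expectCLM, P.coe_expectCLM, P.isConditionalExpectation_expectCLM,
    P.stateHomeomorph, P.toTracialState_apply, P.isAffineMap_stateHomeomorph⟩,
    fun _ hτ _ hb => NCTorus.Torus.map_Ux_eq_zero_of_notMem hτ hb⟩
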